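/- Let \(\mathbb K\) be a subfield of \(\mathbb C\), \(I\) a countable set and \(A=(a_{ij})_{i,j\in I}\) a symmetric matrix with real entries in \(\mathbb K\) such that \(a_{ij}\le 0\) for \(i\ne j\), and \(2a_{ij}/a_{ii}\in\mathbb Z\) for all \(j\) whenever \(a_{ii}>0\). Put \(J=\{i\in I: a_{ii}>0\}\), and assume \(a_{ij}<0\) for all distinct \(i,j\in I\setminus J\). Let \(\mathfrak g\) be the Borcherds algebra of \(A\): the Lie algebra over \(\mathbb K\) with generators \(h_i,e_i,f_i\) \((i\in I)\) and relations \([h_i,h_j]=0\), \([h_i,e_k]=a_{ik}e_k\), \([h_i,f_k]=-a_{ik}f_k\), \([e_i,f_j]=\delta_{ij}h_i\), \((\operatorname{ad}e_i)^{1-2a_{ij}/a_{ii}}e_j=(\operatorname{ad}f_i)^{1-2a_{ij}/a_{ii}}f_j=0\) for \(i\neq j\) with \(a_{ii}>0\), and \([e_i,e_j]=[f_i,f_j]=0\) whenever \(a_{ij}=0\). Let \(\mathfrak g_J\) be the subalgebra generated by the \(e_i,f_i\) with \(i\in J\), \(\mathfrak n_J^-\) the subalgebra generated by the \(f_i\)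 with \(i\in J\), and \[V'=\bigoplus_{i\in I\setminus J}U(\mathfrak n_J^-)\cdot f_i\subseteq\mathfrak g,\] a \(\mathfrak g_J\)-module under the adjoint action. Let \(\pi\) be the representation of \(\mathfrak g_J\) on the tensor algebra \(T(V')\) by derivations extending its action on \(V'\). Let \(G_J\le \mathrm{GL}(T(V'))\) be the subgroup generated by all \(\exp(\pi(x))\), where \(x\) lies in a root space of \(\mathfrak g_J\) for a real root (a root obtained from the simple roots \(\alpha_i\), \(i\in J\), by the Weyl group of \(\mathfrak g_J\)). For a set \(S\), let \(A(S)=\bigoplus_n A_n(S)\) be the free associative \(\mathbb K\)-algebra on \(S\), graded by degree, \(\widehat A(S)=\prod_n A_n(S)\) its completion, \(L(S)\subseteq A(S)\) the Lie subalgebra generated by \(S\), \(\widehat L(S)=\{\sum_{n\ge1}u_n\in\widehat A(S): u_n\in L(S)\cap A_n(S)\}\), and \(G(S)\) the Magnus group, that is, the subgroup of \(\widehat A(S)^\times\) generated by \(\exp(\widehat L(S))\). If \(S'\) is a basis of \(V'\), then \(T(V')\cong A(S')\). The group \(G_J\) acts on \(T(V')\) by algebra automorphisms that preserve the grading, hence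 it acts on \(A(S')\), on \(\widehat A(S')\) (componentwise) and on \(G(S')\) by group automorphisms; \(G(S')\rtimes G_J\) is the semidirect product for this action. **Theorem.** Let \(S_1'\) and \(S_2'\) be two bases of \(V'\). Then the groups \(G(S_1')\rtimes G_J\) and \(G(S_2')\rtimes G_J\) are isomorphic. More precisely, let \(\rho:A(S_1')\to A(S_2')\) be the change-of-basis homomorphism, which sends each \(s\in S_1'\) to its expression as a linear combination of elements of \(S_2'\). Then \(\rho\), applied componentwise, gives an algebra isomorphism \(\widehat\phi:\widehat A(S_1')\to\widehat A(S_2')\), which maps \(\widehat L(S_1')\) onto \(\widehat L(S_2')\) and restricts to a group isomorphism \(\Phi:G(S_1')\to G(S_2')\) with \(\Phi(\exp L)=\exp(\widehat\phi(L))\) for \(L\in\widehat L(S_1')\). Moreover \(\Phi(g\cdot n)=g\cdot\Phi(n)\) for all \(g\in G_J\) and \(n\in G(S_1')\), and \((n,g)\mapsto(\Phi(n),g)\) is an isomorphism \(G(S_1')\rtimes G_J\to G(S_2')\rtimes G_J\). -/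

import Mathlib

noncomputable section

namespace BorcherdsMagnus

attribute [local instance 100] LieRing.ofAssociativeRing

/-! ## Borcherds algebras -/

section Borcherds

variable {K : Subfield ℂ} {I : Type*}

/-- `A` is a (symmetric) Borcherds--Cartan matrix with entries in a subfield `K` of `ℂ`.  The inequalities
between entries presuppose that the entries are real; this is the field `real`. -/
structure IsBorcherdsMatrix (A : Matrix I I K) : Prop where
  real : ∀ i j, (A i j : ℂ).im = 0
  symm : ∀ i j, A i j = A j i
  nonpos : ∀ i j, i ≠ j → (A i j : ℂ).re ≤ 0
  integral : ∀ i, 0 < (A i i : ℂ).re → ∀ j, ∃ n : ℤ, 2 * A i j / A i i = (n : K)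

/-- The set `J` of indices of the real simple roots, `J = {i | a_ii > 0}`. -/
def realIndex (A : Matrix I I K) : Set I := {i | 0 < (A i i : ℂ).re}

/-- Generators `h_i, e_i, f_i` (`i ∈ I`). -/
inductive Gen (I : Type*)
  | h : I → Gen I
  | e : I → Gen I
  | f : I → Gen I

/-- The free Lie algebra on the generators. -/
abbrev FreeGen (K : Subfield ℂ) (I : Type*) := FreeLieAlgebra K (Gen I)

/-- The defining relations, as elements of the free Lie algebra which are set to zero.
In the Serre relations `serre_e`, `serre_f` the exponent is `n + 1`, where `n` is the natural
number `-2 a_ij / a_ii`. -/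
inductive Rel (A : Matrix I I K) : FreeGen K I → Prop
  | hh (i j : I) : Rel A ⁅FreeLieAlgebra.of K (Gen.h i), FreeLieAlgebra.of K (Gen.h j)⁆
  | he (i k : I) : Rel A (⁅FreeLieAlgebra.of K (Gen.h i), FreeLieAlgebra.of K (Gen.e k)⁆
      - A i k • FreeLieAlgebra.of K (Gen.e k))
  | hf (i k : I) : Rel A (⁅FreeLieAlgebra.of K (Gen.h i), FreeLieAlgebra.of K (Gen.f k)⁆
      + A i k • FreeLieAlgebra.of K (Gen.f k))
  | ef_same (i : I) : Rel A (⁅FreeLieAlgebra.of K (Gen.e i), FreeLieAlgebra.of K (Gen.f i)⁆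
      - FreeLieAlgebra.of K (Gen.h i))
  | ef_ne (i j : I) : i ≠ j → Rel A ⁅FreeLieAlgebra.of K (Gen.e i), FreeLieAlgebra.of K (Gen.f j)⁆
  | serre_e (i j : I) (n : ℕ) : i ≠ j → i ∈ realIndex A → (n : K) = -2 * A i j / A i i →
      Rel A (((LieAlgebra.ad K (FreeGen K I) (FreeLieAlgebra.of K (Gen.e i))) ^ (n + 1))
        (FreeLieAlgebra.of K (Gen.e j)))
  | serre_f (i j : I) (n : ℕ) : i ≠ j → i ∈ realIndex A → (n : K) = -2 * A i j / A i i →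
      Rel A (((LieAlgebra.ad K (FreeGen K I) (FreeLieAlgebra.of K (Gen.f i))) ^ (n + 1))
        (FreeLieAlgebra.of K (Gen.f j)))
  | orth_e (i j : I) : A i j = 0 →
      Rel A ⁅FreeLieAlgebra.of K (Gen.e i), FreeLieAlgebra.of K (Gen.e j)⁆
  | orth_f (i j : I) : A i j = 0 →
      Rel A ⁅FreeLieAlgebra.of K (Gen.f i), FreeLieAlgebra.of K (Gen.f j)⁆

/-- The Lie ideal generated by the defining relations. -/
def relIdeal (A : Matrix I I K) : LieIdeal K (FreeGen K I) :=
  LieSubmodule.lieSpan K (FreeGen K I) {x | Rel A x}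

/-- The Borcherds algebra `𝔤` of the matrix `A`. -/
def Borcherds (A : Matrix I I K) : Type _ := FreeGen K I ⧸ relIdeal A

instance (A : Matrix I I K) : LieRing (Borcherds A) :=
  inferInstanceAs (LieRing (FreeGen K I ⧸ relIdeal A))

instance (A : Matrix I I K) : LieAlgebra K (Borcherds A) :=
  inferInstanceAs (LieAlgebra K (FreeGen K I ⧸ relIdeal A))

/-- The quotient map from the free Lie algebra. -/
def toBorcherds (A : Matrix I I K) : FreeGen K I →ₗ⁅K⁆ Borcherds A :=
  { (LieSubmodule.Quotient.mk' (relIdeal A) : FreeGen K I →ₗ[K] FreeGen K I ⧸ relIdeal A) with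
    map_lie' := fun {x y} => LieSubmodule.Quotient.mk_bracket (relIdeal A) x y }

/-- The generator `h_i` of `𝔤`. -/
def h (A : Matrix I I K) (i : I) : Borcherds A := toBorcherds A (FreeLieAlgebra.of K (Gen.h i))

/-- The generator `e_i` of `𝔤`. -/
def e (A : Matrix I I K) (i : I) : Borcherds A := toBorcherds A (FreeLieAlgebra.of K (Gen.e i))

/-- The generator `f_i` of `𝔤`. -/
def f (A : Matrix I I K) (i : I) : Borcherds A := toBorcherds A (FreeLieAlgebra.of K (Gen.f i))

theorem toBorcherds_rel {A : Matrix I I K} {x : FreeGen K I} (hx : Rel A x) :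
    toBorcherds A x = 0 :=
  (LieSubmodule.Quotient.mk_eq_zero (N := relIdeal A)).2 (LieSubmodule.subset_lieSpan hx)

theorem lie_h_f (A : Matrix I I K) (i k : I) : ⁅h A i, f A k⁆ = -(A i k • f A k) := by
  have := toBorcherds_rel (Rel.hf (A := A) i k)
  rw [map_add, LieHom.map_lie, map_smul] at this
  exact eq_neg_of_add_eq_zero_left this

theorem lie_e_f_same (A : Matrix I I K) (i : I) : ⁅e A i, f A i⁆ = h A i := by
  have := toBorcherds_rel (Rel.ef_same (A := A) i)
  rw [map_sub, LieHom.map_lie] at this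
  exact sub_eq_zero.1 this

theorem lie_e_f_ne (A : Matrix I I K) {i j : I} (hij : i ≠ j) : ⁅e A i, f A j⁆ = 0 := by
  have := toBorcherds_rel (Rel.ef_ne (A := A) i j hij)
  rwa [LieHom.map_lie] at this

/-! ### The subalgebra `𝔤_J`, the module `V'` -/

/-- The Kac--Moody (or semisimple) algebra `𝔤_J`, as the subalgebra of `𝔤` generated by the
`e_i, f_i` with `i ∈ J`. -/
def gJ (A : Matrix I I K) : LieSubalgebra K (Borcherds A) :=
  LieSubalgebra.lieSpan K (Borcherds A) (e A '' realIndex A ∪ f A '' realIndex A)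

/-- The subalgebra `𝔫⁻_J`, generated by the `f_i` with `i ∈ J`. -/
def nJminus (A : Matrix I I K) : LieSubalgebra K (Borcherds A) :=
  LieSubalgebra.lieSpan K (Borcherds A) (f A '' realIndex A)

/-- The adjoint action of `U(𝔫⁻_J)` on `𝔤`. -/
def envAction (A : Matrix I I K) :
    UniversalEnvelopingAlgebra K (nJminus A) →ₐ[K] Module.End K (Borcherds A) :=
  UniversalEnvelopingAlgebra.lift K (LieModule.toEnd K (nJminus A) (Borcherds A))

/-- The subspace `V'_i = U(𝔫⁻_J) · f_i` of `𝔤`. -/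
def Vi (A : Matrix I I K) (i : I) : Submodule K (Borcherds A) :=
  LinearMap.range ((LinearMap.applyₗ (f A i)).comp (envAction A).toLinearMap)

theorem f_mem_Vi (A : Matrix I I K) (i : I) : f A i ∈ Vi A i := ⟨1, by simp⟩

theorem lie_nJ_mem_Vi (A : Matrix I I K) (i : I) (x : nJminus A) {v : Borcherds A}
    (hv : v ∈ Vi A i) : ⁅(x : Borcherds A), v⁆ ∈ Vi A i := by
  obtain ⟨u, rfl⟩ := hv
  refine ⟨UniversalEnvelopingAlgebra.ι K x * u, ?_⟩
  simp [envAction]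

theorem Vi_le (A : Matrix I I K) (i : I) (N : Submodule K (Borcherds A)) (h0 : f A i ∈ N)
    (hN : ∀ j ∈ realIndex A, ∀ v ∈ N, ⁅f A j, v⁆ ∈ N) : Vi A i ≤ N := by
  have key : ∀ x ∈ nJminus A, ∀ v ∈ N, ⁅x, v⁆ ∈ N := by
    intro x hx
    induction hx using LieSubalgebra.lieSpan_induction with
    | mem x hx => obtain ⟨j, hj, rfl⟩ := hx; exact hN j hj
    | zero => intro v hv; simp
    | add x y _ _ hx hy => intro v hv; rw [add_lie]; exact N.add_mem (hx v hv) (hy v hv)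
    | smul a x _ hx => intro v hv; rw [smul_lie]; exact N.smul_mem _ (hx v hv)
    | lie x y _ _ hx hy =>
      intro v hv; rw [lie_lie]; exact N.sub_mem (hx _ (hy _ hv)) (hy _ (hx _ hv))
  let S : Subalgebra K (Module.End K (Borcherds A)) :=
    { carrier := {T | ∀ v ∈ N, T v ∈ N}
      mul_mem' := fun {a b} ha hb v hv => ha _ (hb _ hv)
      add_mem' := fun {a b} ha hb v hv => N.add_mem (ha _ hv) (hb _ hv)
      algebraMap_mem' := fun r v hv => by
        rw [Module.algebraMap_end_apply]; exact N.smul_mem _ hv }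
  let φ : nJminus A →ₗ⁅K⁆ S :=
    { toFun := fun x => ⟨LieModule.toEnd K (nJminus A) (Borcherds A) x,
        fun v hv => key x x.2 v hv⟩
      map_add' := fun x y => Subtype.ext (by simp)
      map_smul' := fun a x => Subtype.ext (by simp)
      map_lie' := fun {x y} => Subtype.ext (by
        simp [LieRing.of_associative_ring_bracket]) }
  have hφ : S.val.comp (UniversalEnvelopingAlgebra.lift K φ) = envAction A := by
    ext x v
    simp [envAction, φ]
  rintro _ ⟨u, rfl⟩
  have : envAction A u = (UniversalEnvelopingAlgebra.lift K φ u : S) := by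
    rw [← hφ]; rfl
  change envAction A u (f A i) ∈ N
  rw [this]
  exact (UniversalEnvelopingAlgebra.lift K φ u).2 _ h0

theorem lie_f_mem_Vi (A : Matrix I I K) (i : I) {j : I} (hj : j ∈ realIndex A) {v : Borcherds A}
    (hv : v ∈ Vi A i) : ⁅f A j, v⁆ ∈ Vi A i :=
  lie_nJ_mem_Vi A i ⟨f A j, LieSubalgebra.subset_lieSpan ⟨j, hj, rfl⟩⟩ hv

theorem lie_h_mem_Vi (A : Matrix I I K) (i j : I) {v : Borcherds A} (hv : v ∈ Vi A i) :
    ⁅h A j, v⁆ ∈ Vi A i := by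
  have : Vi A i ≤ Vi A i ⊓ (Vi A i).comap (LieModule.toEnd K (Borcherds A) (Borcherds A) (h A j)) := by
    apply Vi_le
    · refine ⟨f_mem_Vi A i, ?_⟩
      change ⁅h A j, f A i⁆ ∈ Vi A i
      rw [lie_h_f]
      exact (Vi A i).neg_mem ((Vi A i).smul_mem _ (f_mem_Vi A i))
    · rintro k hk v ⟨hv, hv'⟩
      change ⁅h A j, v⁆ ∈ Vi A i at hv'
      refine ⟨lie_f_mem_Vi A i hk hv, ?_⟩
      change ⁅h A j, ⁅f A k, v⁆⁆ ∈ Vi A i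
      rw [leibniz_lie, lie_h_f, neg_lie, smul_lie]
      exact (Vi A i).add_mem ((Vi A i).neg_mem ((Vi A i).smul_mem _ (lie_f_mem_Vi A i hk hv)))
        (lie_f_mem_Vi A i hk hv')
  exact (this hv).2

theorem lie_e_mem_Vi (A : Matrix I I K) {i : I} (hi : i ∉ realIndex A) {j : I}
    (hj : j ∈ realIndex A) {v : Borcherds A} (hv : v ∈ Vi A i) : ⁅e A j, v⁆ ∈ Vi A i := by
  have : Vi A i ≤ Vi A i ⊓ (Vi A i).comap (LieModule.toEnd K (Borcherds A) (Borcherds A) (e A j)) := by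
    apply Vi_le
    · refine ⟨f_mem_Vi A i, ?_⟩
      change ⁅e A j, f A i⁆ ∈ Vi A i
      rw [lie_e_f_ne A (ne_of_mem_of_not_mem hj hi)]
      exact (Vi A i).zero_mem
    · rintro k hk v ⟨hv, hv'⟩
      change ⁅e A j, v⁆ ∈ Vi A i at hv'
      refine ⟨lie_f_mem_Vi A i hk hv, ?_⟩
      change ⁅e A j, ⁅f A k, v⁆⁆ ∈ Vi A i
      rw [leibniz_lie]
      refine (Vi A i).add_mem ?_ (lie_f_mem_Vi A i hk hv')
      by_cases hjk : j = k
      · subst hjk; rw [lie_e_f_same]; exact lie_h_mem_Vi A i j hv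
      · rw [lie_e_f_ne A hjk, zero_lie]; exact (Vi A i).zero_mem
  exact (this hv).2

theorem lie_gJ_mem_Vi (A : Matrix I I K) {i : I} (hi : i ∉ realIndex A) {x : Borcherds A}
    (hx : x ∈ gJ A) : ∀ v ∈ Vi A i, ⁅x, v⁆ ∈ Vi A i := by
  induction hx using LieSubalgebra.lieSpan_induction with
  | mem x hx =>
    intro v hv
    obtain ⟨j, hj, rfl⟩ | ⟨j, hj, rfl⟩ := hx
    · exact lie_e_mem_Vi A hi hj hv
    · exact lie_f_mem_Vi A i hj hv
  | zero => intro v hv; simp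
  | add x y _ _ hx hy => intro v hv; rw [add_lie]; exact (Vi A i).add_mem (hx v hv) (hy v hv)
  | smul a x _ hx => intro v hv; rw [smul_lie]; exact (Vi A i).smul_mem _ (hx v hv)
  | lie x y _ _ hx hy =>
    intro v hv; rw [lie_lie]; exact (Vi A i).sub_mem (hx _ (hy _ hv)) (hy _ (hx _ hv))

/-- The `𝔤_J`-module `V' = ∐_{i ∈ I \ J} U(𝔫⁻_J) · f_i`, as a subspace of `𝔤` with the adjoint
action of `𝔤_J`.  (The sum of the subspaces `V'_i` of `𝔤` is direct, since the `𝔥ᵉ`-weights of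
`V'_i` lie in `-α_i` minus sums of real simple roots.) -/
def V' (A : Matrix I I K) : LieSubmodule K (gJ A) (Borcherds A) where
  toSubmodule := ⨆ i : {i // i ∉ realIndex A}, Vi A i
  lie_mem := by
    intro x v hv
    change ⁅(x : Borcherds A), v⁆ ∈ (⨆ i : {i // i ∉ realIndex A}, Vi A i)
    have : (⨆ i : {i // i ∉ realIndex A}, Vi A i) ≤
        (⨆ i : {i // i ∉ realIndex A}, Vi A i).comap
          (LieModule.toEnd K (Borcherds A) (Borcherds A) (x : Borcherds A)) :=
      iSup_le fun i v hv => Submodule.mem_iSup_of_mem i (lie_gJ_mem_Vi A i.2 x.2 v hv)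
    exact this hv

/-! ### Roots -/

/-- The real roots of `𝔤_J`: the elements of the root lattice `Q = ⨁ ℤ α_i` obtained from the
real simple roots by simple reflections `β ↦ β - (2 (α_i, β) / a_ii) α_i`, `i ∈ J`. -/
inductive IsRealRoot (A : Matrix I I K) : (I →₀ ℤ) → Prop
  | simple (i : I) : i ∈ realIndex A → IsRealRoot A (Finsupp.single i 1)
  | reflect (i : I) (β : I →₀ ℤ) (n : ℤ) : i ∈ realIndex A → IsRealRoot A β →
      (n : K) = 2 * (β.sum fun j m => (m : K) * A i j) / A i i →
      IsRealRoot A (β - Finsupp.single i n)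

/-- `D` is the degree derivation of `𝔤` with `e_i ↦ d_i e_i`, `f_i ↦ -d_i f_i`. -/
def IsDegreeDerivation (A : Matrix I I K) (d : I → K) (D : LieDerivation K (Borcherds A)
    (Borcherds A)) : Prop :=
  ∀ i, D (e A i) = d i • e A i ∧ D (f A i) = -(d i • f A i)

/-- The root space `(𝔤_J)_α`, `α ∈ Q`: the simultaneous eigenspace in `𝔤_J` of all degree
derivations (these include the `ad h_i`), the one given by `d` acting as `α(d) = ∑ α_i d_i`. -/
def rootSpace (A : Matrix I I K) (α : I →₀ ℤ) : Submodule K (gJ A) where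
  carrier := {x | ∀ d D, IsDegreeDerivation A d D →
    D (x : Borcherds A) = (α.sum fun i m => (m : K) * d i) • (x : Borcherds A)}
  add_mem' := fun {x y} hx hy d D hD => by
    simp [hx d D hD, hy d D hD, smul_add]
  zero_mem' := fun d D _ => by simp
  smul_mem' := fun c x hx d D hD => by
    simp [hx d D hD, smul_comm c]

end Borcherds

/-! ## The derivation of the tensor algebra extending an endomorphism -/

section Tensor

variable {K V : Type*} [Field K] [AddCommGroup V] [Module K V]

/-- The algebra map `w ↦ w + ε D(w)` to the dual numbers over the tensor algebra, where `D` is the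
derivation extending `x`. -/
def tensorDual (x : Module.End K V) :
    TensorAlgebra K V →ₐ[K] TrivSqZeroExt (TensorAlgebra K V) (TensorAlgebra K V) :=
  TensorAlgebra.lift K
    ((TrivSqZeroExt.inlAlgHom K (TensorAlgebra K V) (TensorAlgebra K V)).toLinearMap.comp
        (TensorAlgebra.ι K)
      + ((TrivSqZeroExt.inrHom (TensorAlgebra K V) (TensorAlgebra K V)).restrictScalars K).comp
        ((TensorAlgebra.ι K).comp x))

theorem fst_tensorDual (x : Module.End K V) (w : TensorAlgebra K V) :
    (tensorDual x w).fst = w := by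
  have : (TrivSqZeroExt.fstHom K (TensorAlgebra K V) (TensorAlgebra K V)).comp (tensorDual x)
      = AlgHom.id K _ := by
    ext v
    simp [tensorDual]
  exact DFunLike.congr_fun this w

/-- The derivation of `T(V)` extending the endomorphism `x` of `V`, as a linear map. -/
def tensorDer (x : Module.End K V) : Module.End K (TensorAlgebra K V) :=
  ((TrivSqZeroExt.sndHom (TensorAlgebra K V) (TensorAlgebra K V)).restrictScalars K).comp
    (tensorDual x).toLinearMap

theorem tensorDer_ι (x : Module.End K V) (v : V) :
    tensorDer x (TensorAlgebra.ι K v) = TensorAlgebra.ι K (x v) := by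
  simp [tensorDer, tensorDual]

theorem tensorDer_mul (x : Module.End K V) (a b : TensorAlgebra K V) :
    tensorDer x (a * b) = tensorDer x a * b + a * tensorDer x b := by
  have := fst_tensorDual x a
  have := fst_tensorDual x b
  simp only [tensorDer, LinearMap.comp_apply, LinearMap.restrictScalars_apply,
    TrivSqZeroExt.sndHom_apply, AlgHom.toLinearMap_apply, map_mul, TrivSqZeroExt.snd_mul, *]
  simp [add_comm]

theorem tensorDer_algebraMap (x : Module.End K V) (r : K) :
    tensorDer x (algebraMap K _ r) = 0 := by
  simp only [tensorDer, LinearMap.comp_apply, LinearMap.restrictScalars_apply,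
    TrivSqZeroExt.sndHom_apply, AlgHom.toLinearMap_apply, AlgHom.commutes]
  rfl

theorem der_ext (D E : Module.End K (TensorAlgebra K V))
    (hD : ∀ a b, D (a * b) = D a * b + a * D b) (hE : ∀ a b, E (a * b) = E a * b + a * E b)
    (hDr : ∀ r, D (algebraMap K _ r) = 0) (hEr : ∀ r, E (algebraMap K _ r) = 0)
    (h : ∀ v, D (TensorAlgebra.ι K v) = E (TensorAlgebra.ι K v)) : D = E := by
  ext w
  induction w using TensorAlgebra.induction with
  | algebraMap r => rw [hDr, hEr]
  | ι v => exact h v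
  | mul a b ha hb => rw [hD, hE, ha, hb]
  | add a b ha hb => rw [map_add, map_add, ha, hb]

/-- The Lie algebra map `x ↦ tensorDer x` from endomorphisms of `V` to endomorphisms of `T(V)`. -/
def tensorDerHom : Module.End K V →ₗ⁅K⁆ Module.End K (TensorAlgebra K V) where
  toFun := tensorDer
  map_add' := fun x y => by
    apply der_ext
    · exact tensorDer_mul _
    · intro a b
      simp only [LinearMap.add_apply, tensorDer_mul, add_mul, mul_add]; abel
    · exact tensorDer_algebraMap _
    · intro r; simp [tensorDer_algebraMap]
    · intro v; simp [tensorDer_ι]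
  map_smul' := fun c x => by
    apply der_ext
    · exact tensorDer_mul _
    · intro a b
      simp only [LinearMap.smul_apply, RingHom.id_apply, tensorDer_mul, smul_add, smul_mul_assoc,
        mul_smul_comm]
    · exact tensorDer_algebraMap _
    · intro r; simp [tensorDer_algebraMap]
    · intro v; simp [tensorDer_ι]
  map_lie' := fun {x y} => by
    apply der_ext
    · exact tensorDer_mul _
    · intro a b
      simp only [LieRing.of_associative_ring_bracket, LinearMap.sub_apply, Module.End.mul_apply,
        tensorDer_mul, map_add, sub_mul, mul_sub]
      abel
    · exact tensorDer_algebraMap _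
    · intro r; simp [tensorDer_algebraMap, LieRing.of_associative_ring_bracket]
    · intro v; simp [tensorDer_ι, LieRing.of_associative_ring_bracket]

end Tensor

/-! ## Exponentials of locally nilpotent endomorphisms -/

section Exp

variable {K W : Type*} [Field K]

/-- The endomorphism `D` is locally nilpotent and `g = exp D`. -/
def IsExp [AddCommGroup W] [Module K W] (D : Module.End K W) (g : W ≃ₗ[K] W) : Prop :=
  ∀ w, ∃ N : ℕ, (D ^ N) w = 0 ∧
    g w = ∑ n ∈ Finset.range N, ((n.factorial : K)⁻¹) • (D ^ n) w

theorem IsExp.eq_sum [AddCommGroup W] [Module K W] {D : Module.End K W} {g : W ≃ₗ[K] W}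
    (hg : IsExp D g) (w : W) : ∃ N : ℕ, (∀ n, N ≤ n → (D ^ n) w = 0) ∧ ∀ M, N ≤ M →
      g w = ∑ n ∈ Finset.range M, ((n.factorial : K)⁻¹) • (D ^ n) w := by
  obtain ⟨N, hN, h⟩ := hg w
  have h0 : ∀ n, N ≤ n → (D ^ n) w = 0 := by
    intro n hn
    obtain ⟨k, rfl⟩ := Nat.exists_eq_add_of_le hn
    rw [add_comm, pow_add, Module.End.mul_apply, hN, map_zero]
  refine ⟨N, h0, fun M hM => ?_⟩
  rw [h]
  apply Finset.sum_subset (Finset.range_mono hM)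
  intro n _ hn
  rw [h0 n (by simpa using hn), smul_zero]

theorem IsExp.commute [AddCommGroup W] [Module K W] {D : Module.End K W} {g : W ≃ₗ[K] W}
    (hg : IsExp D g) (w : W) : g (D w) = D (g w) := by
  obtain ⟨N, -, h⟩ := hg.eq_sum w
  obtain ⟨N', -, h'⟩ := hg.eq_sum (D w)
  rw [h (max N N') (le_max_left _ _), h' (max N N') (le_max_right _ _), map_sum]
  refine Finset.sum_congr rfl fun n _ => ?_
  rw [map_smul, ← Module.End.mul_apply, ← Module.End.mul_apply, pow_mul_comm']

theorem IsExp.mem_iff [AddCommGroup W] [Module K W] {D : Module.End K W} {g : W ≃ₗ[K] W}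
    (hg : IsExp D g) (N : Submodule K W) (hN : ∀ w ∈ N, D w ∈ N) (w : W) : g w ∈ N ↔ w ∈ N := by
  have hpow : ∀ n, ∀ w ∈ N, (D ^ n) w ∈ N := by
    intro n
    induction n with
    | zero => intro w hw; simpa using hw
    | succ n ih => intro w hw; rw [pow_succ, Module.End.mul_apply]; exact ih _ (hN w hw)
  constructor
  · have key : ∀ m w, (D ^ m) w = 0 → g w ∈ N → w ∈ N := by
      intro m
      induction m with
      | zero => intro w hw _; simp only [pow_zero, Module.End.one_apply] at hw; simp [hw]
      | succ m ih =>
        intro w hw hgw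
        have h1 : D w ∈ N := by
          apply ih
          · rwa [pow_succ, Module.End.mul_apply] at hw
          · rw [hg.commute]; exact hN _ hgw
        obtain ⟨M, -, hM⟩ := hg.eq_sum w
        have h2 := hM (M + 1) (Nat.le_succ M)
        rw [Finset.sum_range_succ'] at h2
        simp only [Nat.factorial_zero, Nat.cast_one, inv_one, pow_zero, Module.End.one_apply,
          one_smul] at h2
        have h3 : w = g w - ∑ k ∈ Finset.range M,
            (((k + 1).factorial : K)⁻¹) • (D ^ (k + 1)) w := by
          rw [h2]; abel
        rw [h3]
        refine N.sub_mem hgw (N.sum_mem fun k _ => N.smul_mem _ ?_)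
        rw [pow_succ, Module.End.mul_apply]
        exact hpow k _ h1
    obtain ⟨M, hM, -⟩ := hg w
    exact key M w hM
  · intro hw
    obtain ⟨M, -, hM⟩ := hg w
    rw [hM]
    exact N.sum_mem fun k _ => N.smul_mem _ (hpow k w hw)

theorem der_pow_mul [Ring W] [Algebra K W] {D : Module.End K W}
    (hD : ∀ a b, D (a * b) = D a * b + a * D b) (n : ℕ) (a b : W) :
    (D ^ n) (a * b) = ∑ ij ∈ Finset.HasAntidiagonal.antidiagonal n,
      n.choose ij.1 • ((D ^ ij.1) a * (D ^ ij.2) b) := by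
  induction n with
  | zero => simp
  | succ n ih =>
    rw [Finset.sum_antidiagonal_choose_succ_nsmul
      (M := W) (fun i j => (D ^ i) a * (D ^ j) b) n, pow_succ', Module.End.mul_apply, ih, map_sum,
      ← Finset.sum_add_distrib]
    refine Finset.sum_congr rfl fun ij hij => ?_
    rw [map_nsmul, hD, pow_succ', pow_succ', Module.End.mul_apply, Module.End.mul_apply, nsmul_add,
      add_comm]
    congr 1
    rw [Nat.choose_symm_of_eq_add (Finset.HasAntidiagonal.mem_antidiagonal.1 hij).symm]

theorem IsExp.map_mul [CharZero K] [Ring W] [Algebra K W] {D : Module.End K W} {g : W ≃ₗ[K] W}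
    (hg : IsExp D g) (hD : ∀ a b, D (a * b) = D a * b + a * D b) (a b : W) :
    g (a * b) = g a * g b := by
  obtain ⟨N₁, z₁, s₁⟩ := hg.eq_sum a
  obtain ⟨N₂, z₂, s₂⟩ := hg.eq_sum b
  obtain ⟨N₃, -, s₃⟩ := hg.eq_sum (a * b)
  set M := N₁ + N₂ + N₃ with hM
  rw [s₁ M (by omega), s₂ M (by omega), s₃ (M + M) (by omega), Finset.sum_mul_sum,
    ← Finset.sum_product',
    ← Finset.sum_fiberwise_of_maps_to (s := Finset.range M ×ˢ Finset.range M)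
      (t := Finset.range (M + M)) (g := fun ij => ij.1 + ij.2)
      (by intro ij; simp only [Finset.mem_product, Finset.mem_range]; omega)]
  refine Finset.sum_congr rfl fun n _ => ?_
  rw [der_pow_mul hD, Finset.smul_sum]
  symm
  apply Finset.sum_subset_zero_on_sdiff
  · intro ij; simp
  · intro ij hij
    simp only [Finset.mem_sdiff, Finset.HasAntidiagonal.mem_antidiagonal, Finset.mem_filter, Finset.mem_product,
      Finset.mem_range, not_and] at hij
    by_cases h1 : ij.1 < M
    · have h2 : M ≤ ij.2 := by
        by_contra h2; exact hij.2 ⟨h1, by omega⟩ hij.1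
      rw [z₂ _ (by omega)]; simp
    · rw [z₁ _ (by omega)]; simp
  · intro ij hij
    simp only [Finset.mem_filter] at hij
    obtain ⟨-, rfl⟩ := hij
    rw [smul_mul_smul_comm, ← Nat.cast_smul_eq_nsmul K, smul_smul]
    congr 1
    have := Nat.add_choose_mul_factorial_mul_factorial ij.1 ij.2
    rw [← Nat.choose_symm_add] at this
    have h := congrArg (Nat.cast (R := K)) this
    push_cast at h
    have h1 : (ij.1.factorial : K) ≠ 0 := Nat.cast_ne_zero.2 (Nat.factorial_ne_zero _)
    have h2 : (ij.2.factorial : K) ≠ 0 := Nat.cast_ne_zero.2 (Nat.factorial_ne_zero _)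
    have h3 : ((ij.1 + ij.2).factorial : K) ≠ 0 := Nat.cast_ne_zero.2 (Nat.factorial_ne_zero _)
    field_simp
    linear_combination -h

end Exp

/-! ## The Magnus algebra and the Magnus group -/

section Magnus

variable (K X : Type*) [Field K]

/-- The homogeneous component `A_n(X)` of the free associative algebra `A(X)`. -/
def homog (n : ℕ) : Submodule K (FreeAlgebra K X) :=
  Submodule.span K (Set.range (FreeAlgebra.ι K)) ^ n

/-- The Magnus algebra `Â(X) = ∏ A_n(X)`.  The family `(u_n)` is encoded as the power series
`∑ u_n tⁿ` over `A(X)`, so that multiplication is `(uv)_n = ∑ u_m v_{n-m}`. -/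
def MagnusAlgebra : Subalgebra K (PowerSeries (FreeAlgebra K X)) where
  carrier := {u | ∀ n, PowerSeries.coeff n u ∈ homog K X n}
  mul_mem' := fun {u v} hu hv n => by
    rw [PowerSeries.coeff_mul]
    refine Submodule.sum_mem _ fun ij hij => ?_
    rw [← Finset.HasAntidiagonal.mem_antidiagonal.1 hij, homog, pow_add]
    exact Submodule.mul_mem_mul (hu _) (hv _)
  add_mem' := fun {u v} hu hv n => by
    rw [map_add]; exact Submodule.add_mem _ (hu n) (hv n)
  algebraMap_mem' := fun r n => by
    rw [PowerSeries.algebraMap_apply, PowerSeries.coeff_C]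
    split_ifs with hn
    · subst hn
      rw [homog, pow_zero]
      exact Submodule.algebraMap_mem r
    · exact Submodule.zero_mem _

variable {K X}

/-- The homogeneous component `u_n` of an element of the Magnus algebra. -/
def component (n : ℕ) (u : MagnusAlgebra K X) : FreeAlgebra K X :=
  PowerSeries.coeff n (u : PowerSeries (FreeAlgebra K X))

theorem magnus_ext {u v : MagnusAlgebra K X} (h : ∀ n, component n u = component n v) : u = v :=
  Subtype.ext (PowerSeries.ext h)

variable (K X)

/-- The free Lie algebra `L(X)`, as the Lie subalgebra of `A(X)` generated by `X`. -/
def freeLie : LieSubalgebra K (FreeAlgebra K X) :=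
  LieSubalgebra.lieSpan K (FreeAlgebra K X) (Set.range (FreeAlgebra.ι K))

/-- The completion `L̂(X) ⊆ Â(X)`: series `∑_{n ≥ 1} u_n` with `u_n ∈ L_n(X) = L(X) ∩ A_n(X)`. -/
def LHat : Set (MagnusAlgebra K X) :=
  {u | component 0 u = 0 ∧ ∀ n, 1 ≤ n → component n u ∈ freeLie K X}

variable {K X}

/-- The exponential `∑_k u^k / k!` of a series without constant term; the `k`-th summand has no
component of degree `< k`. -/
def mexp (u : MagnusAlgebra K X) : MagnusAlgebra K X :=
  ⟨PowerSeries.mk fun n => ∑ k ∈ Finset.range (n + 1), ((k.factorial : K)⁻¹) • component n (u ^ k),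
    fun n => by
      rw [PowerSeries.coeff_mk]
      exact Submodule.sum_mem _ fun k _ => Submodule.smul_mem _ _ ((u ^ k).2 n)⟩

theorem component_mexp (n : ℕ) (u : MagnusAlgebra K X) : component n (mexp u) =
    ∑ k ∈ Finset.range (n + 1), ((k.factorial : K)⁻¹) • component n (u ^ k) := by
  unfold component mexp
  rw [PowerSeries.coeff_mk]
  rfl

variable (K X)

/-- The Magnus group `G(X) = exp(L̂(X))`, the group of units of `Â(X)` generated by the
exponentials of elements of `L̂(X)`. -/
def MagnusGroup : Subgroup (MagnusAlgebra K X)ˣ :=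
  Subgroup.closure {u | ∃ L ∈ LHat K X, (u : MagnusAlgebra K X) = mexp L}

variable {K X}

/-! ### Functoriality for algebra maps that are linear in the variables -/

variable {Y Z : Type*}

theorem map_homog (a : FreeAlgebra K X →ₐ[K] FreeAlgebra K Y)
    (ha : ∀ x, a (FreeAlgebra.ι K x) ∈ Submodule.span K (Set.range (FreeAlgebra.ι K))) (n : ℕ)
    {w : FreeAlgebra K X} (hw : w ∈ homog K X n) : a w ∈ homog K Y n := by
  have : (homog K X n).map a.toLinearMap ≤ homog K Y n := by
    rw [homog, homog, Submodule.map_pow]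
    apply pow_le_pow_left'
    rw [Submodule.map_span, Submodule.span_le]
    rintro _ ⟨_, ⟨x, rfl⟩, rfl⟩
    exact ha x
  exact this ⟨w, hw, rfl⟩

/-- An algebra map `A(X) → A(Y)` sending variables to linear combinations of variables acts
componentwise on the Magnus algebras. -/
def hatMap (a : FreeAlgebra K X →ₐ[K] FreeAlgebra K Y)
    (ha : ∀ x, a (FreeAlgebra.ι K x) ∈ Submodule.span K (Set.range (FreeAlgebra.ι K))) :
    MagnusAlgebra K X →ₐ[K] MagnusAlgebra K Y :=
  ((PowerSeries.mapAlgHom a).comp (MagnusAlgebra K X).val).codRestrict _ fun u n => by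
    change PowerSeries.coeff n (PowerSeries.mapAlgHom a u.1) ∈ homog K Y n
    rw [PowerSeries.mapAlgHom_apply, PowerSeries.coeff_map]
    exact map_homog a ha n (u.2 n)

theorem component_hatMap (a : FreeAlgebra K X →ₐ[K] FreeAlgebra K Y)
    (ha : ∀ x, a (FreeAlgebra.ι K x) ∈ Submodule.span K (Set.range (FreeAlgebra.ι K))) (n : ℕ)
    (u : MagnusAlgebra K X) : component n (hatMap a ha u) = a (component n u) := by
  change PowerSeries.coeff n (PowerSeries.mapAlgHom a u.1) = a (component n u)
  rw [PowerSeries.mapAlgHom_apply, PowerSeries.coeff_map]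
  rfl

theorem hatMap_LHat (a : FreeAlgebra K X →ₐ[K] FreeAlgebra K Y)
    (ha : ∀ x, a (FreeAlgebra.ι K x) ∈ Submodule.span K (Set.range (FreeAlgebra.ι K)))
    {u : MagnusAlgebra K X} (hu : u ∈ LHat K X) : hatMap a ha u ∈ LHat K Y := by
  refine ⟨by rw [component_hatMap, hu.1, map_zero], fun n hn => ?_⟩
  rw [component_hatMap]
  have key : ∀ w ∈ freeLie K X, a w ∈ freeLie K Y := by
    intro w hw
    induction hw using LieSubalgebra.lieSpan_induction with
    | mem x hx =>
      obtain ⟨x, rfl⟩ := hx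
      exact LieSubalgebra.submodule_span_le_lieSpan (ha x)
    | zero => rw [map_zero]; exact (freeLie K Y).zero_mem
    | add x y _ _ hx hy => rw [map_add]; exact (freeLie K Y).add_mem hx hy
    | smul c x _ hx => rw [map_smul]; exact (freeLie K Y).smul_mem c hx
    | lie x y _ _ hx hy =>
      rw [LieRing.of_associative_ring_bracket, map_sub, map_mul, map_mul,
        ← LieRing.of_associative_ring_bracket]
      exact (freeLie K Y).lie_mem hx hy
  exact key _ (hu.2 n hn)

theorem hatMap_mexp (a : FreeAlgebra K X →ₐ[K] FreeAlgebra K Y)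
    (ha : ∀ x, a (FreeAlgebra.ι K x) ∈ Submodule.span K (Set.range (FreeAlgebra.ι K)))
    (u : MagnusAlgebra K X) : hatMap a ha (mexp u) = mexp (hatMap a ha u) := by
  apply magnus_ext
  intro n
  rw [component_hatMap, component_mexp, component_mexp, map_sum]
  refine Finset.sum_congr rfl fun k _ => ?_
  rw [map_smul, ← map_pow, component_hatMap]

/-- The induced homomorphism of Magnus groups. -/
def magnusMap (a : FreeAlgebra K X →ₐ[K] FreeAlgebra K Y)
    (ha : ∀ x, a (FreeAlgebra.ι K x) ∈ Submodule.span K (Set.range (FreeAlgebra.ι K))) :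
    MagnusGroup K X →* MagnusGroup K Y :=
  ((Units.map (hatMap a ha : MagnusAlgebra K X →* MagnusAlgebra K Y)).comp
    (MagnusGroup K X).subtype).codRestrict (MagnusGroup K Y) fun n => by
      have : MagnusGroup K X ≤ (MagnusGroup K Y).comap
          (Units.map (hatMap a ha : MagnusAlgebra K X →* MagnusAlgebra K Y)) := by
        rw [MagnusGroup, Subgroup.closure_le]
        rintro u ⟨L, hL, hu⟩
        refine Subgroup.subset_closure ⟨hatMap a ha L, hatMap_LHat a ha hL, ?_⟩
        change hatMap a ha (u : MagnusAlgebra K X) = _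
        rw [hu, hatMap_mexp]
      exact this n.2

theorem component_magnusMap (a : FreeAlgebra K X →ₐ[K] FreeAlgebra K Y)
    (ha : ∀ x, a (FreeAlgebra.ι K x) ∈ Submodule.span K (Set.range (FreeAlgebra.ι K)))
    (n : ℕ) (u : MagnusGroup K X) :
    component n ((magnusMap a ha u : (MagnusAlgebra K Y)ˣ) : MagnusAlgebra K Y) =
      a (component n ((u : (MagnusAlgebra K X)ˣ) : MagnusAlgebra K X)) :=
  component_hatMap a ha n _

theorem magnusGroup_ext {u v : MagnusGroup K X}
    (h : ∀ n, component n ((u : (MagnusAlgebra K X)ˣ) : MagnusAlgebra K X) =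
      component n ((v : (MagnusAlgebra K X)ˣ) : MagnusAlgebra K X)) : u = v :=
  Subtype.ext (Units.ext (magnus_ext h))

end Magnus

/-! ## The group `G_J` and the semidirect product -/

section Group

variable {K : Subfield ℂ} {I : Type*} (A : Matrix I I K)

/-- The module `W = T(V')`. -/
abbrev W : Type _ := TensorAlgebra K (V' A)

/-- The representation `π` of `𝔤_J` on `W = T(V')` by derivations, extending its action on `V'`. -/
def piRep : gJ A →ₗ⁅K⁆ Module.End K (W A) :=
  tensorDerHom.comp (LieModule.toEnd K (gJ A) (V' A))

/-- The Kac--Moody group `G_J` relative to the module `W`: the subgroup of `GL(W)` generated by the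
`exp(π(x_α))` for `x_α ∈ (𝔤_J)_α`, `α` a real root of `𝔤_J`.  It is the image in `GL(W)`, hence the
quotient by the kernel of the action, of the free product of the groups `(𝔤_J)_α`.  (`W` is an
integrable module, so every such `π(x_α)` is locally nilpotent and has an exponential.) -/
def GJ : Subgroup (W A ≃ₗ[K] W A) :=
  Subgroup.closure {g | ∃ α, IsRealRoot A α ∧ ∃ x ∈ rootSpace A α, IsExp (piRep A x) g}

theorem piRep_mul (x : gJ A) (a b : W A) :
    piRep A x (a * b) = piRep A x a * b + a * piRep A x b :=
  tensorDer_mul _ a b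

theorem piRep_range (x : gJ A) (w : W A) (hw : w ∈ LinearMap.range (TensorAlgebra.ι K (M := V' A))) :
    piRep A x w ∈ LinearMap.range (TensorAlgebra.ι K (M := V' A)) := by
  obtain ⟨v, rfl⟩ := hw
  exact ⟨_, (tensorDer_ι _ v).symm⟩

theorem GJ_spec (g : GJ A) : (∀ a b : W A, g.1 (a * b) = g.1 a * g.1 b) ∧
    ∀ w, g.1 w ∈ LinearMap.range (TensorAlgebra.ι K (M := V' A)) ↔
      w ∈ LinearMap.range (TensorAlgebra.ι K (M := V' A)) := by
  obtain ⟨g, hg⟩ := g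
  induction hg using Subgroup.closure_induction with
  | mem g hg =>
    obtain ⟨α, -, x, -, hx⟩ := hg
    exact ⟨hx.map_mul (piRep_mul A x), hx.mem_iff _ (piRep_range A x)⟩
  | one => exact ⟨fun _ _ => rfl, fun _ => Iff.rfl⟩
  | mul g₁ g₂ _ _ h₁ h₂ =>
    refine ⟨fun a b => ?_, fun w => (h₁.2 _).trans (h₂.2 w)⟩
    change g₁ (g₂ (a * b)) = g₁ (g₂ a) * g₁ (g₂ b)
    rw [h₂.1, h₁.1]
  | inv g _ h =>
    refine ⟨fun a b => ?_, fun w => ?_⟩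
    · apply g.injective
      change g (g.symm (a * b)) = g (g.symm a * g.symm b)
      rw [h.1]; simp
    · rw [← h.2]
      change g (g.symm w) ∈ _ ↔ _
      rw [LinearEquiv.apply_symm_apply]

theorem GJ_one (g : GJ A) : g.1 (1 : W A) = 1 := by
  have := (GJ_spec A g).1 1 (g.1.symm 1)
  simpa using this.symm

/-- The elements of `G_J` are algebra automorphisms of `T(V')`. -/
def GJalg : GJ A →* (W A ≃ₐ[K] W A) where
  toFun g := AlgEquiv.ofLinearEquiv g.1 (GJ_one A g) (GJ_spec A g).1
  map_one' := rfl
  map_mul' _ _ := rfl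

variable {A} {S : Type*} (b : Module.Basis S K (V' A))

/-- The action of `G_J` on `A(S')`, transferred along the isomorphism `T(V') ≃ A(S')` given by the
basis `S'` of `V'`. -/
def GJfree : GJ A →* (FreeAlgebra K S ≃ₐ[K] FreeAlgebra K S) :=
  (AlgEquiv.autCongr (TensorAlgebra.equivFreeAlgebra b)).toMonoidHom.comp (GJalg A)

theorem GJfree_apply (g : GJ A) (w : FreeAlgebra K S) : GJfree b g w =
    TensorAlgebra.equivFreeAlgebra b (g.1 ((TensorAlgebra.equivFreeAlgebra b).symm w)) := rfl

theorem GJfree_linear (g : GJ A) (s : S) : (GJfree b g : FreeAlgebra K S →ₐ[K] FreeAlgebra K S)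
    (FreeAlgebra.ι K s) ∈ Submodule.span K (Set.range (FreeAlgebra.ι K)) := by
  change GJfree b g (FreeAlgebra.ι K s) ∈
    Submodule.span K (Set.range (FreeAlgebra.ι K : S → FreeAlgebra K S))
  rw [GJfree_apply, TensorAlgebra.equivFreeAlgebra_symm_ι]
  obtain ⟨v, hv⟩ := ((GJ_spec A g).2 (TensorAlgebra.ι K (b s))).2 ⟨b s, rfl⟩
  rw [← hv]
  clear hv
  have : ⊤ ≤ (Submodule.span K (Set.range (FreeAlgebra.ι K : S → FreeAlgebra K S))).comap
      ((TensorAlgebra.equivFreeAlgebra b).toLinearMap.comp (TensorAlgebra.ι K)) := by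
    rw [← b.span_eq, Submodule.span_le]
    rintro _ ⟨t, rfl⟩
    change TensorAlgebra.equivFreeAlgebra b (TensorAlgebra.ι K (b t)) ∈
      Submodule.span K (Set.range (FreeAlgebra.ι K : S → FreeAlgebra K S))
    rw [TensorAlgebra.equivFreeAlgebra_ι_apply]
    exact Submodule.subset_span ⟨t, rfl⟩
  exact this (Submodule.mem_top (x := v))

theorem GJaction_inv (g : GJ A) (u : MagnusGroup K S) :
    magnusMap (GJfree b g⁻¹ : FreeAlgebra K S →ₐ[K] FreeAlgebra K S) (GJfree_linear b g⁻¹)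
      (magnusMap (GJfree b g : FreeAlgebra K S →ₐ[K] FreeAlgebra K S) (GJfree_linear b g) u)
      = u := by
  apply magnusGroup_ext
  intro n
  rw [component_magnusMap, component_magnusMap]
  change (GJfree b g⁻¹ * GJfree b g) _ = _
  rw [← map_mul, inv_mul_cancel, map_one]
  rfl

/-- The action `φ : G_J → Aut(G(S'))` of `G_J` on the Magnus group: `G_J` acts on series in
`G(S') ⊆ Â(S')` componentwise, through its action on `A(S')`. -/
def GJaction : GJ A →* MulAut (MagnusGroup K S) where
  toFun g :=
    { magnusMap (GJfree b g : FreeAlgebra K S →ₐ[K] FreeAlgebra K S) (GJfree_linear b g) with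
      invFun := magnusMap (GJfree b g⁻¹ : FreeAlgebra K S →ₐ[K] FreeAlgebra K S)
        (GJfree_linear b g⁻¹)
      left_inv := fun u => GJaction_inv b g u
      right_inv := fun u => by simpa using GJaction_inv b g⁻¹ u }
  map_one' := by
    ext1 u
    apply magnusGroup_ext
    intro n
    exact (component_magnusMap _ (GJfree_linear b 1) n u).trans (by rw [map_one]; rfl)
  map_mul' g g' := by
    ext1 u
    apply magnusGroup_ext
    intro n
    refine (component_magnusMap _ (GJfree_linear b (g * g')) n u).trans ?_
    refine Eq.trans ?_ (component_magnusMap _ (GJfree_linear b g) n _).symm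
    refine Eq.trans ?_ (congrArg _ (component_magnusMap _ (GJfree_linear b g') n u).symm)
    rw [map_mul]
    rfl

/-- The semidirect product `G(S') ⋊ G_J`, with `(n₁, g₁)(n₂, g₂) = (n₁ φ(g₁)(n₂), g₁ g₂)`. -/
abbrev BigGroup : Type _ := MagnusGroup K S ⋊[GJaction b] GJ A

/-- The change-of-basis map on free associative algebras: a variable `s`, i.e. the basis vector
`b₁ s` of `V'`, goes to its expression as a linear combination of the variables of the second
basis. -/
def changeOfBasis {S₁ S₂ : Type*} (b₁ : Module.Basis S₁ K (V' A)) (b₂ : Module.Basis S₂ K (V' A)) :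
    FreeAlgebra K S₁ →ₐ[K] FreeAlgebra K S₂ :=
  FreeAlgebra.lift K fun s => (b₂.repr (b₁ s)).sum fun t c => c • FreeAlgebra.ι K t

end Group

end BorcherdsMagnus

end

/-! A basis `b` of V' gives an isomorphism `TensorAlgebra.equivFreeAlgebra b` from T(V') to the free
algebra on the basis; call it ε₁ for `b₁` and ε₂ for `b₂`. The change-of-basis homomorphism ρ is ε₂
∘ ε₁⁻¹ (`changeOfBasis_eq`): both are algebra maps on a free algebra, and on a variable both give
the expansion of a vector of the first basis in the second. This one identity carries the proof.

It shows that ρ is invertible, its inverse being the change of basis in the other direction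
(`changeOfBasis_changeOfBasis`). It also gives equivariance. G_J acts on T(V') without reference to
a basis, and its action on each free algebra is the conjugate by ε₁ or ε₂, so ρ intertwines the two
conjugates (`changeOfBasis_GJfree`).

It remains to pass from free algebras to their completions. An algebra map sending variables to
linear combinations of variables respects degree and the Lie subalgebra generated by the variables.
It therefore acts componentwise on series, preserves the completed Lie algebra, commutes with the
exponential and induces a map of Magnus groups. Series are determined by their components, so
identities between such maps, namely being mutually inverse or commuting with G_J, lift from free
algebras to Magnus algebras and Magnus groups. An equivariant isomorphism of Magnus groups, paired
with the identity of G_J, is an isomorphism of semidirect products. -/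

noncomputable section

namespace BorcherdsMagnus

/-! ### Invertible linear substitutions on Magnus algebras and Magnus groups -/

section MutuallyInverse

variable {K : Type*} [Field K] {X Y : Type*}
  (a : FreeAlgebra K X →ₐ[K] FreeAlgebra K Y)
  (ha : ∀ x, a (FreeAlgebra.ι K x) ∈ Submodule.span K (Set.range (FreeAlgebra.ι K)))
  (c : FreeAlgebra K Y →ₐ[K] FreeAlgebra K X)
  (hc : ∀ y, c (FreeAlgebra.ι K y) ∈ Submodule.span K (Set.range (FreeAlgebra.ι K)))

/-- A series is determined by its components, and on each component the composite is `c ∘ a`. The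
one-sided form serves both composites in `hatEquiv`, with the roles of `a` and `c` exchanged. -/
theorem hatMap_hatMap_of_leftInverse (hca : ∀ w, c (a w) = w) (u : MagnusAlgebra K X) :
    hatMap c hc (hatMap a ha u) = u :=
  magnus_ext fun n => by rw [component_hatMap, component_hatMap, hca]

/-- Commutative squares of free algebras lift to Magnus groups, since each component of a series is
moved by the underlying algebra map. The square needed later has a change of basis on two opposite
sides and an element of G_J on the other two. -/
theorem magnusMap_comm {Z T : Type*} {a : FreeAlgebra K X →ₐ[K] FreeAlgebra K Y}
    {b : FreeAlgebra K Y →ₐ[K] FreeAlgebra K Z} {a' : FreeAlgebra K X →ₐ[K] FreeAlgebra K T}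
    {b' : FreeAlgebra K T →ₐ[K] FreeAlgebra K Z}
    (ha : ∀ x, a (FreeAlgebra.ι K x) ∈ Submodule.span K (Set.range (FreeAlgebra.ι K)))
    (hb : ∀ x, b (FreeAlgebra.ι K x) ∈ Submodule.span K (Set.range (FreeAlgebra.ι K)))
    (ha' : ∀ x, a' (FreeAlgebra.ι K x) ∈ Submodule.span K (Set.range (FreeAlgebra.ι K)))
    (hb' : ∀ x, b' (FreeAlgebra.ι K x) ∈ Submodule.span K (Set.range (FreeAlgebra.ι K)))
    (hab : ∀ w, b (a w) = b' (a' w)) (u : MagnusGroup K X) :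
    magnusMap b hb (magnusMap a ha u) = magnusMap b' hb' (magnusMap a' ha' u) :=
  magnusGroup_ext fun n => by
    rw [component_magnusMap, component_magnusMap, component_magnusMap, component_magnusMap, hab]

theorem magnusMap_magnusMap_of_leftInverse (hca : ∀ w, c (a w) = w) (u : MagnusGroup K X) :
    magnusMap c hc (magnusMap a ha u) = u :=
  magnusGroup_ext fun n => by rw [component_magnusMap, component_magnusMap, hca]

/-- Mutually inverse linear substitutions of the variables induce an isomorphism of Magnus
algebras. -/
def hatEquiv (hca : ∀ w, c (a w) = w) (hac : ∀ w, a (c w) = w) :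
    MagnusAlgebra K X ≃ₐ[K] MagnusAlgebra K Y :=
  AlgEquiv.ofAlgHom (hatMap a ha) (hatMap c hc)
    (AlgHom.ext (hatMap_hatMap_of_leftInverse c hc a ha hac))
    (AlgHom.ext (hatMap_hatMap_of_leftInverse a ha c hc hca))

/-- The inverse substitution is again linear in the variables, so it too preserves the completed Lie
algebra; applying it to the image recovers `u`. As the map is bijective, the equivalence says that
one completed Lie algebra is carried onto the other. -/
theorem hatEquiv_mem_LHat_iff (hca : ∀ w, c (a w) = w) (hac : ∀ w, a (c w) = w)
    (u : MagnusAlgebra K X) :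
    hatEquiv a ha c hc hca hac u ∈ LHat K Y ↔ u ∈ LHat K X := by
  refine ⟨fun hu => ?_, hatMap_LHat a ha⟩
  rw [← hatMap_hatMap_of_leftInverse a ha c hc hca u]
  exact hatMap_LHat c hc hu

/-- Mutually inverse linear substitutions of the variables induce an isomorphism of Magnus
groups. -/
def magnusEquiv (hca : ∀ w, c (a w) = w) (hac : ∀ w, a (c w) = w) :
    MagnusGroup K X ≃* MagnusGroup K Y :=
  MonoidHom.toMulEquiv (magnusMap a ha) (magnusMap c hc)
    (MonoidHom.ext (magnusMap_magnusMap_of_leftInverse a ha c hc hca))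
    (MonoidHom.ext (magnusMap_magnusMap_of_leftInverse c hc a ha hac))

end MutuallyInverse

/-! ### Change of basis of V' and its compatibility with G_J -/

section ChangeOfBasis

variable {K : Subfield ℂ} {I : Type*} {A : Matrix I I K} {S₁ S₂ : Type*}
  (b₁ : Module.Basis S₁ K (V' A)) (b₂ : Module.Basis S₂ K (V' A))

theorem changeOfBasis_ι (s : S₁) : changeOfBasis b₁ b₂ (FreeAlgebra.ι K s) =
    (b₂.repr (b₁ s)).sum fun t c => c • FreeAlgebra.ι K t :=
  FreeAlgebra.lift_ι_apply _ _

/-- This is the linearity condition under which `hatMap` and `magnusMap` are defined. -/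
theorem changeOfBasis_ι_mem_span (s : S₁) : changeOfBasis b₁ b₂ (FreeAlgebra.ι K s) ∈
    Submodule.span K (Set.range (FreeAlgebra.ι K)) := by
  rw [changeOfBasis_ι]
  exact Submodule.sum_mem _ fun t _ =>
    Submodule.smul_mem _ _ (Submodule.subset_span ⟨t, rfl⟩)

/-- The definition of `changeOfBasis` uses coordinates; here it is factored through T(V'), where no
basis is involved. Invertibility and equivariance then become cancellations of an isomorphism
against its inverse. -/
theorem changeOfBasis_eq (w : FreeAlgebra K S₁) : changeOfBasis b₁ b₂ w =
    TensorAlgebra.equivFreeAlgebra b₂ ((TensorAlgebra.equivFreeAlgebra b₁).symm w) := by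
  have : changeOfBasis b₁ b₂ =
      ((TensorAlgebra.equivFreeAlgebra b₂ : W A →ₐ[K] FreeAlgebra K S₂)).comp
        ((TensorAlgebra.equivFreeAlgebra b₁).symm : FreeAlgebra K S₁ →ₐ[K] W A) := by
    apply FreeAlgebra.hom_ext
    funext s
    change changeOfBasis b₁ b₂ (FreeAlgebra.ι K s) = TensorAlgebra.equivFreeAlgebra b₂
      ((TensorAlgebra.equivFreeAlgebra b₁).symm (FreeAlgebra.ι K s))
    rw [changeOfBasis_ι, TensorAlgebra.equivFreeAlgebra_symm_ι]
    -- Only the right side is expanded: there `b₁ s` is a vector of V' still to be written in the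
    -- second basis, while on the left it occurs inside the coordinates themselves.
    conv_rhs => rw [← b₂.linearCombination_repr (b₁ s), Finsupp.linearCombination_apply]
    rw [Finsupp.sum, Finsupp.sum, map_sum, map_sum]
    refine Finset.sum_congr rfl fun t _ => ?_
    rw [map_smul, map_smul, TensorAlgebra.equivFreeAlgebra_ι_apply]
  exact DFunLike.congr_fun this w

theorem changeOfBasis_changeOfBasis (w : FreeAlgebra K S₁) :
    changeOfBasis b₂ b₁ (changeOfBasis b₁ b₂ w) = w := by
  rw [changeOfBasis_eq, changeOfBasis_eq, AlgEquiv.symm_apply_apply, AlgEquiv.apply_symm_apply]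

/-- With ε₁, ε₂ the isomorphisms from T(V') to the two free algebras, `g` acts as ε₁ g ε₁⁻¹ and as
ε₂ g ε₂⁻¹, and the change of basis is ε₂ ε₁⁻¹. Both sides therefore reduce to ε₂ g ε₁⁻¹. -/
theorem changeOfBasis_GJfree (g : GJ A) (w : FreeAlgebra K S₁) :
    changeOfBasis b₁ b₂ (GJfree b₁ g w) = GJfree b₂ g (changeOfBasis b₁ b₂ w) := by
  rw [changeOfBasis_eq b₁ b₂ w, changeOfBasis_eq b₁ b₂ (GJfree b₁ g w)]
  -- `GJfree` unfolds definitionally to the conjugate of `g`. Under the common outer map, the first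
  -- cancellation removes ε₁⁻¹ ε₁ to the left of `g`, and the second inserts ε₂⁻¹ ε₂ to its right.
  exact congrArg (TensorAlgebra.equivFreeAlgebra b₂)
    (((TensorAlgebra.equivFreeAlgebra b₁).symm_apply_apply _).trans
      (congrArg g.1 ((TensorAlgebra.equivFreeAlgebra b₂).symm_apply_apply _).symm))

/-- The isomorphism of Magnus algebras given by a change of basis of `V'`. -/
def magnusAlgebraChangeOfBasis : MagnusAlgebra K S₁ ≃ₐ[K] MagnusAlgebra K S₂ :=
  hatEquiv _ (changeOfBasis_ι_mem_span b₁ b₂) _ (changeOfBasis_ι_mem_span b₂ b₁)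
    (changeOfBasis_changeOfBasis b₁ b₂) (changeOfBasis_changeOfBasis b₂ b₁)

/-- The isomorphism of Magnus groups given by a change of basis of `V'`. -/
def magnusGroupChangeOfBasis : MagnusGroup K S₁ ≃* MagnusGroup K S₂ :=
  magnusEquiv _ (changeOfBasis_ι_mem_span b₁ b₂) _ (changeOfBasis_ι_mem_span b₂ b₁)
    (changeOfBasis_changeOfBasis b₁ b₂) (changeOfBasis_changeOfBasis b₂ b₁)

theorem magnusAlgebraChangeOfBasis_mexp (u : MagnusAlgebra K S₁) :
    magnusAlgebraChangeOfBasis b₁ b₂ (mexp u) = mexp (magnusAlgebraChangeOfBasis b₁ b₂ u) :=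
  hatMap_mexp _ (changeOfBasis_ι_mem_span b₁ b₂) u

/-- This is the condition under which the isomorphism of Magnus groups extends, by the identity of
G_J, to the semidirect products. -/
theorem magnusGroupChangeOfBasis_GJaction (g : GJ A) (n : MagnusGroup K S₁) :
    magnusGroupChangeOfBasis b₁ b₂ (GJaction b₁ g n) =
      GJaction b₂ g (magnusGroupChangeOfBasis b₁ b₂ n) :=
  magnusMap_comm (GJfree_linear b₁ g) (changeOfBasis_ι_mem_span b₁ b₂)
    (changeOfBasis_ι_mem_span b₁ b₂) (GJfree_linear b₂ g) (changeOfBasis_GJfree b₁ b₂ g) n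

/-- The isomorphism `G(S₁') ⋊ G_J ≃ G(S₂') ⋊ G_J` given by a change of basis of `V'`. -/
def bigGroupChangeOfBasis : BigGroup b₁ ≃* BigGroup b₂ :=
  SemidirectProduct.congr (magnusGroupChangeOfBasis b₁ b₂) (MulEquiv.refl (GJ A)) fun g =>
    MulEquiv.ext (magnusGroupChangeOfBasis_GJaction b₁ b₂ g)

end ChangeOfBasis

end BorcherdsMagnus

end

/-! ### The main theorem -/

theorem theorem3p5 {K : Subfield ℂ} {I : Type*} [Countable I] (A : Matrix I I K)
    (hA : BorcherdsMagnus.IsBorcherdsMatrix A)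
    (hneg : ∀ i j, i ∉ BorcherdsMagnus.realIndex A → j ∉ BorcherdsMagnus.realIndex A → i ≠ j →
      (A i j : ℂ).re < 0)
    {S₁ S₂ : Type*} (b₁ : Module.Basis S₁ K (BorcherdsMagnus.V' A))
    (b₂ : Module.Basis S₂ K (BorcherdsMagnus.V' A)) :
    ∃ φ : BorcherdsMagnus.MagnusAlgebra K S₁ ≃ₐ[K] BorcherdsMagnus.MagnusAlgebra K S₂,
      (∀ u n, BorcherdsMagnus.component n (φ u) =
        BorcherdsMagnus.changeOfBasis b₁ b₂ (BorcherdsMagnus.component n u)) ∧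
      (∀ u, φ u ∈ BorcherdsMagnus.LHat K S₂ ↔ u ∈ BorcherdsMagnus.LHat K S₁) ∧
      ∃ Φ : BorcherdsMagnus.MagnusGroup K S₁ ≃* BorcherdsMagnus.MagnusGroup K S₂,
        (∀ n, ((Φ n).1 : BorcherdsMagnus.MagnusAlgebra K S₂) = φ n.1) ∧
        (∀ L ∈ BorcherdsMagnus.LHat K S₁, ∀ n : BorcherdsMagnus.MagnusGroup K S₁,
          (n.1 : BorcherdsMagnus.MagnusAlgebra K S₁) = BorcherdsMagnus.mexp L →
          ((Φ n).1 : BorcherdsMagnus.MagnusAlgebra K S₂) = BorcherdsMagnus.mexp (φ L)) ∧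
        (∀ (g : BorcherdsMagnus.GJ A) (n : BorcherdsMagnus.MagnusGroup K S₁),
          Φ (BorcherdsMagnus.GJaction b₁ g n) = BorcherdsMagnus.GJaction b₂ g (Φ n)) ∧
        ∃ Ψ : BorcherdsMagnus.BigGroup b₁ ≃* BorcherdsMagnus.BigGroup b₂,
          ∀ x, Ψ x = ⟨Φ x.left, x.right⟩ :=
  ⟨BorcherdsMagnus.magnusAlgebraChangeOfBasis b₁ b₂,
    fun u n => BorcherdsMagnus.component_hatMap _ (BorcherdsMagnus.changeOfBasis_ι_mem_span b₁ b₂) n u,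
    BorcherdsMagnus.hatEquiv_mem_LHat_iff _ _ _ _ _ _,
    BorcherdsMagnus.magnusGroupChangeOfBasis b₁ b₂,
    -- The group isomorphism and the algebra isomorphism come from the same `hatMap`, so on
    -- underlying series they agree by definition.
    fun _ => rfl,
    -- `mexp L` is only an element of the Magnus algebra, so exp L enters as a group element `n`
    -- whose underlying series is `mexp L`. The algebra isomorphism is applied to that equation and
    -- moved inside the exponential.
    fun L _ _ hn => (congrArg (BorcherdsMagnus.magnusAlgebraChangeOfBasis b₁ b₂) hn).trans
      (BorcherdsMagnus.magnusAlgebraChangeOfBasis_mexp b₁ b₂ L),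
    BorcherdsMagnus.magnusGroupChangeOfBasis_GJaction b₁ b₂,
    BorcherdsMagnus.bigGroupChangeOfBasis b₁ b₂,
    fun _ => rfl⟩
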